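/- **Setting.** A quantum system is a complex Hilbert space $\mathcal H$ of finite or infinite dimension; $\mathcal D(\mathcal H)$ is the set of its density operators, with the trace norm topology. A channel $\mathcal H\to\mathcal K$ is a completely positive trace-preserving linear map on trace-class operators (equivalently, a normal unital completely positive map $\tilde{\mathcal E}:B(\mathcal K)\to B(\mathcal H)$ with $\operatorname{tr}[\mathcal E(T)B]=\operatorname{tr}[T\tilde{\mathcal E}(B)]$); the set of channels carries the bounded weak topology, the weakest one making $\mathcal E\mapsto \operatorname{tr}[\mathcal E(T)B]$ continuous for all trace-class $T$ and bounded $B$. A quantum resource theory on a class of quantum systems that contains $\mathbb C$ and is closed under (Hilbert space) tensor products assigns to each system $\mathcal H$ a compact set of states $\mathcal S(\mathcal H)\subseteq\mathcal D(\mathcal H)$ and to each pair a compact set $\mathcal O(\mathcal H\to\mathcal K)$ of channels mapping $\mathcal S(\mathcal H)$ into $\mathcal S(\mathcal K)$ (the free operations; $\mathcal O(\mathcal H)=\mathcal O(\mathcal H\to\mathcal H)$), such that compositions and tensor products of free operations are free, each identity map is free, and each trace $\operatorname{tr}:\mathcal H\to\mathbb C$ is free. Here $\mathbb C\otimes\mathcal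 H$, $\mathcal H$ and $\mathcal H\otimes\mathbb C$ are identified, and so are $(\mathcal H_1\otimes\mathcal H_2)\otimes\mathcal H_3$ and $\mathcal H_1\otimes(\mathcal H_2\otimes\mathcal H_3)$. For $\phi,\psi\in\mathcal S(\mathcal H)$ write $\phi\succeq\psi$ if $\mathcal N(\phi)=\psi$ for some $\mathcal N\in\mathcal O(\mathcal H)$, and $\phi\sim\psi$ if $\phi\succeq\psi$ and $\psi\succeq\phi$. Let $$\mathcal G(\mathcal H)=\{\phi\in\mathcal S(\mathcal H):\forall\psi\in\mathcal S(\mathcal H),\ \psi\succeq\phi\Rightarrow\phi\succeq\psi\}$$ be the set of maximally resourceful states, and let $$\mathcal F(\mathcal H)=\{\psi\in\mathcal S(\mathcal H):\forall\mathcal H'\ \forall\phi\in\mathcal S(\mathcal H')\ \exists\mathcal N\in\mathcal O(\mathcal H'\to\mathcal H),\ \mathcal N(\phi)=\psi\}$$ be the set of free states. For states $\phi$ on $\mathcal H_1$ and $\psi$ on $\mathcal H_2$ let $r_{\rm conv}(\phi\to\psi)\in[0,\infty]$ be the supremum of all real $r\ge 0$ for which there are $\mathcal N_n\in\mathcal O(\mathcal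 H_1^{\otimes n}\to\mathcal H_2^{\otimes\lceil rn\rceil})$, $n\in\mathbb N$, with $$\lim_{n\to\infty}\bigl\|\mathcal N_n(\phi^{\otimes n})-\psi^{\otimes\lceil rn\rceil}\bigr\|_1=0 .$$ A state $\psi\in\mathcal S(\mathcal H)\setminus\mathcal F(\mathcal H)$ with $r_{\rm conv}(\psi\to\psi)=\infty$ is called catalytically replicable. Given a normalization constant $R_{\max}^{(\mathcal H)}\in[0,\infty)$, the resource cost of $\psi\in\mathcal S(\mathcal H)$ is $$R_{\rm C}(\psi)=\inf_{\phi\in\mathcal S(\mathcal H)}\frac{R_{\max}^{(\mathcal H)}}{r_{\rm conv}(\phi\to\psi)}\in[0,\infty].$$ **Theorem (Maximally Resourceful State that Maximizes Resource Cost).** Let $\mathcal H$ be a quantum system of a quantum resource theory. Suppose that no state in $\mathcal S(\mathcal H)$ is catalytically replicable, that $\mathcal S(\mathcal H)\setminus\mathcal F(\mathcal H)\neq\emptyset$, and that the set $\mathcal G(\mathcal H)/{\sim}$ of equivalence classes of maximally resourceful states is finite. Then there is a maximally resourceful state $\phi\in\mathcal G(\mathcal H)$ with $$R_{\rm C}(\phi)=R_{\max}^{(\mathcal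 H)}.$$ -/

import Mathlib

open Filter Topology
open scoped TensorProduct NNReal ENNReal InnerProductSpace ComplexOrder

noncomputable section

/-! ## Quantum systems -/

/-- A quantum system: a complex Hilbert space, of finite or infinite dimension. -/
structure QSystem : Type 1 where
  carrier : Type
  [normed : NormedAddCommGroup carrier]
  [innerProduct : InnerProductSpace ℂ carrier]
  [complete : CompleteSpace carrier]

attribute [instance] QSystem.normed QSystem.innerProduct QSystem.complete

/-- `B(H)`, the bounded operators on a quantum system, with the operator norm. -/
abbrev QSystem.Op (H : QSystem) : Type := H.carrier →L[ℂ] H.carrier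

/-- The trivial system `ℂ`. -/
def QSystem.unit : QSystem := ⟨ℂ⟩

/-- The composite system: the Hilbert space tensor product, i.e. the completion of the algebraic
tensor product with respect to its inner product. -/
def QSystem.tensor (H K : QSystem) : QSystem :=
  ⟨UniformSpace.Completion (H.carrier ⊗[ℂ] K.carrier)⟩

/-- `H^{⊗ n}`, with `H^{⊗ 0} = ℂ`. -/
def QSystem.pow (H : QSystem) : ℕ → QSystem
  | 0 => QSystem.unit
  | n + 1 => (QSystem.pow H n).tensor H

/-- The vector `x ⊗ y` of the composite system. -/
def QSystem.tmul {H K : QSystem} (x : H.carrier) (y : K.carrier) : (H.tensor K).carrier :=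
  ((x ⊗ₜ[ℂ] y : H.carrier ⊗[ℂ] K.carrier) : UniformSpace.Completion (H.carrier ⊗[ℂ] K.carrier))

/-- The operator `A ⊗ B` on the composite system. -/
def QSystem.opTensor {H K : QSystem} (A : H.Op) (B : K.Op) : (H.tensor K).Op :=
  (TensorProduct.mapL A B).completion

/-! ## Trace-class operators and states -/

/-- A bounded functional `f` on `B(H)` is normal (ultraweakly continuous), that is, of the form
`f A = tr (T A)` with `T` a trace-class operator, if
`f A = ∑ n, ⟪x n, A (y n)⟫` for two square-summable sequences of vectors
(then `T = ∑ n, |y n⟩⟨x n|`). -/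
def IsNormalFunctional {H : QSystem} (f : StrongDual ℂ H.Op) : Prop :=
  ∃ x y : ℕ → H.carrier, Summable (fun n => ‖x n‖ ^ 2) ∧ Summable (fun n => ‖y n‖ ^ 2) ∧
    ∀ A : H.Op, HasSum (fun n => ⟪x n, A (y n)⟫_ℂ) (f A)

/-- The predual of `B(H)`, i.e. the trace-class operators `T` on `H`, each identified with the
normal functional `A ↦ tr (T A)`. The norm of this functional on `B(H)` is the trace norm
`‖T‖₁ = tr |T|`; the topology, inherited from the dual norm, is the trace norm topology. The value
at the operator `1` is the trace `tr T`. -/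
def TraceClass (H : QSystem) : Type := {f : StrongDual ℂ H.Op // IsNormalFunctional f}

instance (H : QSystem) : TopologicalSpace (TraceClass H) :=
  inferInstanceAs (TopologicalSpace {f : StrongDual ℂ H.Op // IsNormalFunctional f})

/-- `‖S - T‖₁`, the trace norm distance. -/
def traceDist {H : QSystem} (S T : TraceClass H) : ℝ := ‖S.1 - T.1‖

/-- `D(H)`, the density operators (quantum states): positive normal functionals `f` with
`f 1 = 1`. -/
def densityOperators (H : QSystem) : Set (TraceClass H) :=
  {ψ | (∀ M : H.Op, 0 ≤ ψ.1 (star M * M)) ∧ ψ.1 1 = 1}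

theorem exists_hasSum_dual {F : Type} [NormedAddCommGroup F] [NormedSpace ℂ F]
    (v : ℕ → StrongDual ℂ F) (g : ℕ → ℝ) (hg : Summable g) (hv : ∀ n a, ‖v n a‖ ≤ g n * ‖a‖)
    (hg0 : ∀ n, 0 ≤ g n) : ∃ f : StrongDual ℂ F, ∀ a, HasSum (fun n => v n a) (f a) := by
  have hs : Summable v := Summable.of_norm_bounded hg
    fun n => ContinuousLinearMap.opNorm_le_bound _ (hg0 n) (hv n)
  exact ⟨∑' n, v n, fun a => (ContinuousLinearMap.apply ℂ ℂ a).hasSum hs.hasSum⟩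

/-- Two square-summable sequences of vectors define a bounded functional `A ↦ ∑ n, ⟪x n, A (y n)⟫`
on the bounded operators. -/
theorem exists_vectorFunctional {E : Type} [NormedAddCommGroup E] [InnerProductSpace ℂ E]
    (x y : ℕ → E) (hx : Summable (fun n => ‖x n‖ ^ 2)) (hy : Summable (fun n => ‖y n‖ ^ 2)) :
    ∃ f : StrongDual ℂ (E →L[ℂ] E), ∀ A : E →L[ℂ] E,
      HasSum (fun n => ⟪x n, A (y n)⟫_ℂ) (f A) := by
  refine exists_hasSum_dual (F := E →L[ℂ] E)
    (fun n => (innerSL ℂ (x n)).comp (ContinuousLinearMap.apply ℂ E (y n)))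
    (fun n => ‖x n‖ ^ 2 + ‖y n‖ ^ 2) (hx.add hy) (fun n A => ?_) (fun n => by positivity)
  calc ‖⟪x n, A (y n)⟫_ℂ‖ ≤ ‖x n‖ * ‖A (y n)‖ := norm_inner_le_norm _ _
    _ ≤ ‖x n‖ * (‖A‖ * ‖y n‖) := by gcongr; exact A.le_opNorm _
    _ = ‖x n‖ * ‖y n‖ * ‖A‖ := by ring
    _ ≤ (‖x n‖ ^ 2 + ‖y n‖ ^ 2) * ‖A‖ := by
      gcongr
      nlinarith [sq_nonneg (‖x n‖ - ‖y n‖), sq_nonneg ‖x n‖, sq_nonneg ‖y n‖]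

/-- The state `1` of the trivial system `ℂ`: the functional `A ↦ A 1` on `B(ℂ) = ℂ`. -/
def unitState : TraceClass QSystem.unit :=
  ⟨ContinuousLinearMap.apply ℂ ℂ (1 : ℂ), fun n => if n = 0 then (1 : ℂ) else 0,
    fun n => if n = 0 then (1 : ℂ) else 0, by
    have h : ∀ n, n ∉ ({0} : Finset ℕ) → ‖if n = 0 then (1 : ℂ) else 0‖ ^ 2 = 0 := by
      intro n hn
      rw [Finset.mem_singleton] at hn
      simp [hn]
    refine ⟨summable_of_ne_finset_zero h, summable_of_ne_finset_zero h, fun (A : ℂ →L[ℂ] ℂ) => ?_⟩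
    have key : HasSum (fun n : ℕ => ⟪if n = 0 then (1 : ℂ) else 0,
        A (if n = 0 then (1 : ℂ) else 0)⟫_ℂ) ⟪(1 : ℂ), A 1⟫_ℂ := by
      convert hasSum_single (f := fun n : ℕ => ⟪if n = 0 then (1 : ℂ) else 0,
        A (if n = 0 then (1 : ℂ) else 0)⟫_ℂ) 0 (fun n hn => by simp [hn]) using 1
      simp
    have h1 : ⟪(1 : ℂ), A 1⟫_ℂ = A 1 := by simp
    rw [h1] at key
    exact key⟩

theorem QSystem.norm_tmul {H K : QSystem} (x : H.carrier) (y : K.carrier) :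
    ‖QSystem.tmul x y‖ = ‖x‖ * ‖y‖ :=
  (UniformSpace.Completion.norm_coe _).trans (TensorProduct.norm_tmul x y)

theorem QSystem.inner_tmul_opTensor {H K : QSystem} (A : H.Op) (B : K.Op)
    (x y : H.carrier) (z w : K.carrier) :
    ⟪QSystem.tmul x z, QSystem.opTensor A B (QSystem.tmul y w)⟫_ℂ = ⟪x, A y⟫_ℂ * ⟪z, B w⟫_ℂ := by
  have h : QSystem.opTensor A B (QSystem.tmul y w) = QSystem.tmul (A y) (B w) :=
    ContinuousLinearMap.completion_apply_coe _ _
  rw [h]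
  exact (UniformSpace.Completion.inner_coe _ _).trans (by simp)

theorem summable_pair_mul (e : ℕ ≃ ℕ × ℕ) {a b : ℕ → ℝ} (ha : Summable (fun n => a n ^ 2))
    (hb : Summable (fun n => b n ^ 2)) :
    Summable (fun n : ℕ => (a (e n).1 * b (e n).2) ^ 2) := by
  have h1 : Summable (fun p : ℕ × ℕ => a p.1 ^ 2 * b p.2 ^ 2) :=
    ha.mul_of_nonneg hb (fun _ => sq_nonneg _) (fun _ => sq_nonneg _)
  have h2 : Summable (fun n : ℕ => a (e n).1 ^ 2 * b (e n).2 ^ 2) := h1.comp_injective e.injective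
  simpa only [mul_pow] using h2

theorem hasSum_pair_mul (e : ℕ ≃ ℕ × ℕ) {a b : ℕ → ℂ} {s t : ℂ} (ha : HasSum a s)
    (hb : HasSum b t) : HasSum (fun n : ℕ => a (e n).1 * b (e n).2) (s * t) := by
  have ha' : Summable (fun n => ‖a n‖) := ha.summable.norm
  have hb' : Summable (fun n => ‖b n‖) := hb.summable.norm
  have h1 : Summable (fun p : ℕ × ℕ => a p.1 * b p.2) := summable_mul_of_summable_norm ha' hb'
  have h2 : HasSum (fun p : ℕ × ℕ => a p.1 * b p.2) (s * t) := ha.mul hb h1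
  exact e.hasSum_iff.mpr h2

/-- Existence of the tensor product of two trace-class operators. -/
theorem exists_tensorProduct {H K : QSystem} (S : TraceClass H) (T : TraceClass K) :
    ∃ R : TraceClass (H.tensor K), ∀ (A : H.Op) (B : K.Op),
      R.1 (QSystem.opTensor A B) = S.1 A * T.1 B := by
  obtain ⟨f, x, y, hx, hy, hf⟩ := S
  obtain ⟨g, z, w, hz, hw, hg⟩ := T
  obtain ⟨e⟩ : Nonempty (ℕ ≃ ℕ × ℕ) := ⟨Nat.pairEquiv.symm⟩
  have hX : Summable (fun n : ℕ => ‖QSystem.tmul (x (e n).1) (z (e n).2)‖ ^ 2) :=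
    (summable_pair_mul e hx hz).congr fun n =>
      congrArg (· ^ 2) (QSystem.norm_tmul (x (e n).1) (z (e n).2)).symm
  have hY : Summable (fun n : ℕ => ‖QSystem.tmul (y (e n).1) (w (e n).2)‖ ^ 2) :=
    (summable_pair_mul e hy hw).congr fun n =>
      congrArg (· ^ 2) (QSystem.norm_tmul (y (e n).1) (w (e n).2)).symm
  obtain ⟨R, hR⟩ := exists_vectorFunctional _ _ hX hY
  refine ⟨⟨R, _, _, hX, hY, hR⟩, fun A B => ?_⟩
  have h1 := hR (QSystem.opTensor A B)
  have h2 := hasSum_pair_mul e (hf A) (hg B)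
  have h3 := funext fun n => QSystem.inner_tmul_opTensor A B
    (x (e n).1) (y (e n).1) (z (e n).2) (w (e n).2)
  rw [h3] at h1
  exact h1.unique h2

/-- The tensor product `S ⊗ T` of trace-class operators: the (unique) trace-class operator on the
composite system with `tr ((S ⊗ T) (A ⊗ B)) = tr (S A) * tr (T B)` for all `A` and `B`. -/
def TraceClass.tensor {H K : QSystem} (S : TraceClass H) (T : TraceClass K) :
    TraceClass (H.tensor K) :=
  Classical.choose (exists_tensorProduct S T)

/-- `ψ^{⊗ n}`, with `ψ^{⊗ 0} = 1`. -/
def TraceClass.pow {H : QSystem} (ψ : TraceClass H) : (n : ℕ) → TraceClass (H.pow n)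
  | 0 => unitState
  | n + 1 => (TraceClass.pow ψ n).tensor ψ

/-! ## Channels -/

/-- A quantum channel from `H` to `K`, given by its Heisenberg picture `B(K) → B(H)`: a completely
positive, unital, normal linear map. (Such maps are automatically bounded.) -/
@[ext]
structure Channel (H K : QSystem) where
  heis : K.Op →L[ℂ] H.Op
  completelyPositive : ∀ (n : ℕ) (A : Fin n → H.Op) (B : Fin n → K.Op),
    (∑ j, ∑ k, star (A j) * heis (star (B j) * B k) * A k).IsPositive
  unital : heis 1 = 1
  normal : ∀ f : StrongDual ℂ H.Op, IsNormalFunctional f → IsNormalFunctional (f.comp heis)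

/-- The Schrödinger picture of a channel: the completely positive trace-preserving map `T ↦ E(T)`
on trace-class operators determined by `tr (E(T) B) = tr (T E.heis(B))`. -/
def Channel.map {H K : QSystem} (E : Channel H K) (T : TraceClass H) : TraceClass K :=
  ⟨T.1.comp E.heis, E.normal T.1 T.2⟩

/-- The bounded weak (BW) topology: the weakest topology for which all the maps
`E ↦ tr (E(T) B)`, with `T` trace-class on `H` and `B` bounded on `K`, are continuous. -/
instance (H K : QSystem) : TopologicalSpace (Channel H K) :=
  ⨅ (T : TraceClass H) (B : K.Op),
    TopologicalSpace.induced (fun E : Channel H K => (E.map T).1 B) inferInstance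

/-! ## Quantum resource theories -/

/-- A quantum resource theory. A channel is determined by its action on trace-class operators
(for a composite input, on product operators), so that each clause of the form
"there is a free operation acting as ..." says that this particular channel is free.
The last six clauses express that `ℂ ⊗ H`, `H`, `H ⊗ ℂ`, and `(H₁ ⊗ H₂) ⊗ H₃`, `H₁ ⊗ (H₂ ⊗ H₃)`,
are regarded as the same system: the canonical identifications, in both directions, are free. -/
structure QRT where
  /-- The quantum systems that the theory deals with, for instance all of them. -/
  systems : Set QSystem
  unit_mem : QSystem.unit ∈ systems
  tensor_mem : ∀ H ∈ systems, ∀ K ∈ systems, H.tensor K ∈ systems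
  /-- `S(H)`: the set of states of interest. -/
  S : ∀ H : QSystem, Set (TraceClass H)
  S_subset : ∀ H ∈ systems, S H ⊆ densityOperators H
  S_compact : ∀ H ∈ systems, IsCompact (S H)
  /-- `O(H → K)`: the set of free operations. -/
  O : ∀ H K : QSystem, Set (Channel H K)
  O_compact : ∀ H ∈ systems, ∀ K ∈ systems, IsCompact (O H K)
  O_maps : ∀ H ∈ systems, ∀ K ∈ systems, ∀ N ∈ O H K, ∀ φ ∈ S H, N.map φ ∈ S K
  /-- Compositions of free operations are free. -/
  comp_free : ∀ H₁ ∈ systems, ∀ H₂ ∈ systems, ∀ H₃ ∈ systems, ∀ M ∈ O H₁ H₂, ∀ N ∈ O H₂ H₃,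
    ∃ L ∈ O H₁ H₃, ∀ T, L.map T = N.map (M.map T)
  /-- Tensor products of free operations are free. -/
  tensor_free : ∀ H₁ ∈ systems, ∀ K₁ ∈ systems, ∀ H₂ ∈ systems, ∀ K₂ ∈ systems,
    ∀ M ∈ O H₁ K₁, ∀ N ∈ O H₂ K₂,
    ∃ L ∈ O (H₁.tensor H₂) (K₁.tensor K₂), ∀ (T₁ : TraceClass H₁) (T₂ : TraceClass H₂),
      L.map (T₁.tensor T₂) = (M.map T₁).tensor (N.map T₂)
  /-- The identity map is free. -/
  id_free : ∀ H ∈ systems, ∃ L ∈ O H H, ∀ T, L.map T = T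
  /-- The trace is free. -/
  trace_free : ∀ H ∈ systems, ∃ L ∈ O H QSystem.unit, ∀ T, (L.map T).1 = T.1 1 • unitState.1
  rightUnit_free : ∀ H ∈ systems, ∃ L ∈ O (H.tensor QSystem.unit) H,
    ∀ T, L.map (T.tensor unitState) = T
  rightUnit_symm_free : ∀ H ∈ systems, ∃ L ∈ O H (H.tensor QSystem.unit),
    ∀ T, L.map T = T.tensor unitState
  leftUnit_free : ∀ H ∈ systems, ∃ L ∈ O (QSystem.unit.tensor H) H,
    ∀ T, L.map (unitState.tensor T) = T
  leftUnit_symm_free : ∀ H ∈ systems, ∃ L ∈ O H (QSystem.unit.tensor H),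
    ∀ T, L.map T = unitState.tensor T
  assoc_free : ∀ H₁ ∈ systems, ∀ H₂ ∈ systems, ∀ H₃ ∈ systems,
    ∃ L ∈ O ((H₁.tensor H₂).tensor H₃) (H₁.tensor (H₂.tensor H₃)),
      ∀ (T₁ : TraceClass H₁) (T₂ : TraceClass H₂) (T₃ : TraceClass H₃),
      L.map ((T₁.tensor T₂).tensor T₃) = T₁.tensor (T₂.tensor T₃)
  assoc_symm_free : ∀ H₁ ∈ systems, ∀ H₂ ∈ systems, ∀ H₃ ∈ systems,
    ∃ L ∈ O (H₁.tensor (H₂.tensor H₃)) ((H₁.tensor H₂).tensor H₃),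
      ∀ (T₁ : TraceClass H₁) (T₂ : TraceClass H₂) (T₃ : TraceClass H₃),
      L.map (T₁.tensor (T₂.tensor T₃)) = (T₁.tensor T₂).tensor T₃

namespace QRT

/-- The preorder `φ ⪰ ψ`: some free operation converts `φ` into `ψ`. -/
def Geq (Q : QRT) {H : QSystem} (φ ψ : TraceClass H) : Prop :=
  ∃ N ∈ Q.O H H, N.map φ = ψ

/-- The equivalence `φ ∼ ψ`. -/
def Equivalent (Q : QRT) {H : QSystem} (φ ψ : TraceClass H) : Prop :=
  Q.Geq φ ψ ∧ Q.Geq ψ φ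

/-- `G(H)`: the maximally resourceful states. -/
def G (Q : QRT) (H : QSystem) : Set (TraceClass H) :=
  {φ | φ ∈ Q.S H ∧ ∀ ψ ∈ Q.S H, Q.Geq ψ φ → Q.Geq φ ψ}

/-- `G(H)/∼`: the set of equivalence classes of the maximally resourceful states. -/
def maximalClasses (Q : QRT) (H : QSystem) : Set (Set (TraceClass H)) :=
  {C | ∃ φ ∈ Q.G H, C = {ψ | ψ ∈ Q.G H ∧ Q.Equivalent ψ φ}}

/-- `F(H)`: the free states. -/
def F (Q : QRT) (H : QSystem) : Set (TraceClass H) :=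
  {ψ | ψ ∈ Q.S H ∧ ∀ H' ∈ Q.systems, ∀ φ ∈ Q.S H', ∃ N ∈ Q.O H' H, ψ = N.map φ}

/-- The achievable rates of asymptotic conversion of `φ` into `ψ`: the rates `r ≥ 0` at which free
operations convert `φ^{⊗ n}` into `ψ^{⊗ ⌈r n⌉}` with vanishing trace norm error as `n → ∞`. -/
def achievableRates (Q : QRT) {H K : QSystem} (φ : TraceClass H) (ψ : TraceClass K) : Set ℝ :=
  {r | 0 ≤ r ∧ ∃ N : (n : ℕ) → Channel (H.pow n) (K.pow ⌈r * n⌉₊),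
    (∀ n, N n ∈ Q.O (H.pow n) (K.pow ⌈r * n⌉₊)) ∧
    Tendsto (fun n => traceDist ((N n).map (φ.pow n)) (ψ.pow ⌈r * n⌉₊)) atTop (𝓝 0)}

/-- The asymptotic conversion rate, a number in `[0, ∞]`. -/
def convRate (Q : QRT) {H K : QSystem} (φ : TraceClass H) (ψ : TraceClass K) : ℝ≥0∞ :=
  ⨆ r ∈ Q.achievableRates φ ψ, ENNReal.ofReal r

/-- A catalytically replicable state: a resource state `ψ` with infinite rate `ψ → ψ`. -/
def IsCatalyticallyReplicable (Q : QRT) {H : QSystem} (ψ : TraceClass H) : Prop :=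
  ψ ∈ Q.S H \ Q.F H ∧ Q.convRate ψ ψ = ∞

/-- The resource cost `R_C`, with normalization constant `Rmax`. In `[0, ∞]`, division satisfies
`a / ∞ = 0`, and `a / 0 = ∞` for `a ≠ 0`. -/
def resourceCost (Q : QRT) {H : QSystem} (Rmax : ℝ≥0) (ψ : TraceClass H) : ℝ≥0∞ :=
  ⨅ φ ∈ Q.S H, (Rmax : ℝ≥0∞) / Q.convRate φ ψ

end QRT

end

/-! ## Channels are contractive -/

namespace Channel

variable {H K : QSystem}

/-! It suffices to find a maximally resourceful `φ` that no state reaches at a rate above one: the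
rate from `φ` to itself is at least one, so the infimum defining the cost is attained at `φ`.
Suppose there is none. Compactness and Zorn's lemma put a maximal state above every state
(`exists_mem_G_geq`), so each maximal state is reached at a rate above one from another maximal
state. Iterating gives an infinite backward sequence. Rates multiply under composition
(`mul_mem_achievableRates`), and with finitely many classes two members of the sequence are
equivalent; hence one of them converts to itself at a rate above one. Powers of that rate are
achievable too, so the self-rate is infinite. This state is not free, since a free maximal state
makes all states free (`S_subset_F`); it is therefore catalytically replicable, a contradiction.
Contractivity of channels serves both the compactness argument and the addition of errors in
composed protocols. -/

theorem heis_star_mul_self_isPositive (E : Channel H K) (B : K.Op) :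
    (E.heis (star B * B)).IsPositive := by
  simpa using E.completelyPositive 1 (fun _ => 1) (fun _ => B)

/-- Polarization: images of `star C * C` are self-adjoint, and `C = B`, `1 + B`, `1 + I • B` give
enough linear relations. -/
theorem heis_star (E : Channel H K) (B : K.Op) : E.heis (star B) = star (E.heis B) := by
  have hsa : ∀ C : K.Op, star (E.heis (star C * C)) = E.heis (star C * C) :=
    fun C => (E.heis_star_mul_self_isPositive C).isSelfAdjoint
  have h0 := hsa B
  have h1 := hsa (1 + B)
  have h2 := hsa (1 + Complex.I • B)
  have e1 : star (1 + B) * (1 + B) = 1 + B + star B + star B * B := by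
    rw [star_add, star_one]; noncomm_ring
  have e2 : star (1 + Complex.I • B) * (1 + Complex.I • B)
      = 1 + Complex.I • B - Complex.I • star B + star B * B := by
    simp only [star_add, star_one, star_smul, add_mul, mul_add, one_mul, mul_one,
      smul_mul_assoc, mul_smul_comm, smul_add, smul_neg, smul_smul, RCLike.star_def, Complex.conj_I, neg_mul,
      Complex.I_mul_I, neg_neg, neg_smul, one_smul]
    abel
  rw [e1] at h1
  rw [e2] at h2
  simp only [map_add, map_sub, map_smul, E.unital, star_add, star_sub, star_one, star_smul, h0,
    RCLike.star_def, Complex.conj_I, neg_smul] at h1 h2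
  have h1' : star (E.heis B) + star (E.heis (star B)) = E.heis B + E.heis (star B) := by
    have := add_right_cancel h1
    rw [add_assoc, add_assoc] at this
    exact add_left_cancel this
  have h2' : Complex.I • (star (E.heis (star B)) - star (E.heis B))
      = Complex.I • (E.heis B - E.heis (star B)) := by
    have := add_right_cancel h2
    rw [sub_eq_add_neg, sub_eq_add_neg, add_assoc, add_assoc] at this
    have := add_left_cancel this
    rw [smul_sub, smul_sub, sub_eq_add_neg, sub_eq_add_neg, ← this]
    abel
  have h3 := smul_right_injective _ Complex.I_ne_zero h2'
  have h4 : (2 : ℂ) • E.heis (star B) = (2 : ℂ) • star (E.heis B) := by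
    rw [two_smul, two_smul]
    have a1 := sub_eq_sub_iff_add_eq_add.mp h3
    have := congrArg₂ (· - ·) h1' h3
    calc _ = (E.heis B + E.heis (star B)) - (E.heis B - E.heis (star B)) := by abel
      _ = _ := by rw [← this]; abel
  exact smul_right_injective _ two_ne_zero h4

/-- The Kadison–Schwarz inequality. -/
theorem star_heis_mul_heis_le (E : Channel H K) (B : K.Op) :
    star (E.heis B) * E.heis B ≤ E.heis (star B * B) := by
  -- With these entries the double sum collapses to `E.heis (star B * B) - star (E.heis B) * E.heis
  -- B`.
  have h := E.completelyPositive 2 ![1, -E.heis B] ![B, 1]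
  rw [ContinuousLinearMap.le_def]
  simpa [Fin.sum_univ_two, E.unital, E.heis_star, sub_eq_add_neg] using h

theorem heis_le_of_norm (E : Channel H K) (B : K.Op) :
    E.heis (star B * B) ≤ algebraMap ℝ H.Op (‖B‖ ^ 2) := by
  have h1 : star B * B ≤ algebraMap ℝ K.Op (‖B‖ ^ 2) := by
    simpa [CStarRing.norm_star_mul_self, sq] using
      (IsSelfAdjoint.star_mul_self B).le_algebraMap_norm_self
  -- Positivity of `heis` is known on elements `star C * C`, so the difference is factored in this
  -- form.
  obtain ⟨C, hC⟩ := CStarAlgebra.nonneg_iff_eq_star_mul_self.mp (sub_nonneg.mpr h1)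
  have h2 := E.heis_star_mul_self_isPositive C
  rw [← hC, map_sub] at h2
  rw [ContinuousLinearMap.le_def]
  have h3 : E.heis (algebraMap ℝ K.Op (‖B‖ ^ 2)) = algebraMap ℝ H.Op (‖B‖ ^ 2) := by
    rw [Algebra.algebraMap_eq_smul_one, Algebra.algebraMap_eq_smul_one,
      ← Complex.coe_smul, ← Complex.coe_smul, map_smul, E.unital]
  rwa [h3] at h2

theorem norm_heis_le (E : Channel H K) (B : K.Op) : ‖E.heis B‖ ≤ ‖B‖ := by
  have h := (E.star_heis_mul_heis_le B).trans (E.heis_le_of_norm B)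
  have h2 : ‖star (E.heis B) * E.heis B‖ ≤ ‖B‖ ^ 2 :=
    (CStarAlgebra.norm_le_iff_le_algebraMap _ (sq_nonneg _) (star_mul_self_nonneg _)).mpr h
  rw [CStarRing.norm_star_mul_self, ← sq] at h2
  exact le_of_sq_le_sq h2 (norm_nonneg _)

/-- The trace norm is the dual norm, so contractivity of the Heisenberg map transposes. -/
theorem traceDist_map_le (E : Channel H K) (S T : TraceClass H) :
    traceDist (E.map S) (E.map T) ≤ traceDist S T := by
  refine ContinuousLinearMap.opNorm_le_bound _ (norm_nonneg _) fun B => ?_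
  calc ‖(S.1 - T.1) (E.heis B)‖ ≤ ‖S.1 - T.1‖ * ‖E.heis B‖ := ContinuousLinearMap.le_opNorm _ _
    _ ≤ traceDist S T * ‖B‖ :=
      mul_le_mul_of_nonneg_left (E.norm_heis_le B) (norm_nonneg _)

theorem continuous_map_apply (T : TraceClass H) (B : K.Op) :
    Continuous fun E : Channel H K => (E.map T).1 B :=
  continuous_iInf_dom (continuous_iInf_dom continuous_induced_dom)

/-- Separate continuity is upgraded to joint continuity by the bound `‖T - T₀‖ * ‖B‖`, uniform in
the channel, on the change caused by moving the state. -/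
theorem continuous_uncurry_map_apply (B : K.Op) :
    Continuous fun p : Channel H K × TraceClass H => (p.1.map p.2).1 B := by
  rw [continuous_iff_continuousAt]
  rintro ⟨E₀, T₀⟩
  have h1 : Tendsto (fun p : Channel H K × TraceClass H => (p.1.map T₀).1 B) (𝓝 (E₀, T₀))
      (𝓝 ((E₀.map T₀).1 B)) :=
    ((continuous_map_apply T₀ B).comp continuous_fst).tendsto (E₀, T₀)
  have h2 : Tendsto (fun p : Channel H K × TraceClass H => (p.2.1 - T₀.1) (p.1.heis B))
      (𝓝 (E₀, T₀)) (𝓝 0) := by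
    have h3 : Continuous fun p : Channel H K × TraceClass H => ‖p.2.1 - T₀.1‖ * ‖B‖ :=
      (((continuous_subtype_val.comp continuous_snd).sub continuous_const).norm).mul
        continuous_const
    have h4 := h3.tendsto (E₀, T₀)
    simp only [sub_self, norm_zero, zero_mul] at h4
    refine squeeze_zero_norm (fun p => ?_) h4
    exact (ContinuousLinearMap.le_opNorm _ _).trans
      (mul_le_mul_of_nonneg_left (p.1.norm_heis_le B) (norm_nonneg _))
  have h5 := h1.add h2
  rw [add_zero] at h5
  refine h5.congr fun p => ?_
  change T₀.1 (p.1.heis B) + (p.2.1 (p.1.heis B) - T₀.1 (p.1.heis B)) = p.2.1 (p.1.heis B)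
  ring

end Channel

theorem traceDist_triangle {H : QSystem} (R S T : TraceClass H) :
    traceDist R T ≤ traceDist R S + traceDist S T :=
  norm_sub_le_norm_sub_add_norm_sub _ _ _

instance (H : QSystem) : T2Space (TraceClass H) :=
  inferInstanceAs (T2Space {f : StrongDual ℂ H.Op // IsNormalFunctional f})

namespace QRT

variable {Q : QRT} {H K L : QSystem}

/-! ## Maximally resourceful states -/

theorem Geq.refl (hH : H ∈ Q.systems) (φ : TraceClass H) : Q.Geq φ φ := by
  obtain ⟨N, hN, h⟩ := Q.id_free H hH
  exact ⟨N, hN, h φ⟩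

theorem Geq.trans (hH : H ∈ Q.systems) {φ ψ χ : TraceClass H} (h₁ : Q.Geq φ ψ)
    (h₂ : Q.Geq ψ χ) : Q.Geq φ χ := by
  obtain ⟨M, hM, rfl⟩ := h₁
  obtain ⟨N, hN, rfl⟩ := h₂
  obtain ⟨P, hP, h⟩ := Q.comp_free H hH H hH H hH M hM N hN
  exact ⟨P, hP, h φ⟩

/-- This set is the projection of a closed subset of the compact product of free operations and
states. -/
theorem isCompact_setOf_geq (hH : H ∈ Q.systems) (χ : TraceClass H) :
    IsCompact {ψ | ψ ∈ Q.S H ∧ Q.Geq ψ χ} := by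
  have hc : IsClosed {p : Channel H H × TraceClass H | p.1.map p.2 = χ} := by
    have : {p : Channel H H × TraceClass H | p.1.map p.2 = χ}
        = ⋂ B : H.Op, {p | (p.1.map p.2).1 B = χ.1 B} := by
      ext p
      simp only [Set.mem_ofPred_eq, Set.mem_iInter]
      exact ⟨fun h B => by rw [h], fun h => Subtype.ext (ContinuousLinearMap.ext h)⟩
    rw [this]
    exact isClosed_iInter fun B =>
      isClosed_eq (Channel.continuous_uncurry_map_apply B) continuous_const
  have hk := (((Q.O_compact H hH H hH).prod (Q.S_compact H hH)).inter_right hc).image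
    continuous_snd
  convert hk using 1
  ext ψ
  constructor
  · rintro ⟨hψ, N, hN, h⟩
    exact ⟨(N, ψ), ⟨⟨hN, hψ⟩, h⟩, rfl⟩
  · rintro ⟨⟨N, ψ'⟩, ⟨⟨hN, hψ⟩, h⟩, rfl⟩
    exact ⟨hψ, N, hN, h⟩

theorem exists_mem_G_geq (hH : H ∈ Q.systems) {χ : TraceClass H} (hχ : χ ∈ Q.S H) :
    ∃ g ∈ Q.G H, Q.Geq g χ := by
  let U : TraceClass H → Set (TraceClass H) := fun a => {ψ | ψ ∈ Q.S H ∧ Q.Geq ψ a}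
  have hbd : ∀ c : Set (U χ), IsChain (fun a b : U χ => Q.Geq b.1 a.1) c →
      ∃ ub : U χ, ∀ a ∈ c, Q.Geq ub.1 a.1 := by
    intro c hc
    rcases c.eq_empty_or_nonempty with rfl | ⟨a₀, ha₀⟩
    · exact ⟨⟨χ, hχ, Geq.refl hH χ⟩, by simp⟩
    have : Nonempty c := ⟨⟨a₀, ha₀⟩⟩
    -- The sets of states above the members of a chain are nested, nonempty and compact; a common
    -- point is an upper bound.
    have hne := IsCompact.nonempty_iInter_of_directed_nonempty_isCompact_isClosed
      (fun a : c => U a.1.1) (fun a b => by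
        rcases eq_or_ne a b with rfl | hab
        · exact ⟨a, subset_rfl, subset_rfl⟩
        rcases hc a.2 b.2 (fun h => hab (Subtype.ext h)) with h | h
        · exact ⟨b, fun ψ hψ => ⟨hψ.1, hψ.2.trans hH h⟩, subset_rfl⟩
        · exact ⟨a, subset_rfl, fun ψ hψ => ⟨hψ.1, hψ.2.trans hH h⟩⟩)
      (fun a => ⟨a.1.1, a.1.2.1, Geq.refl hH _⟩)
      (fun a => isCompact_setOf_geq hH _) (fun a => (isCompact_setOf_geq hH _).isClosed)
    obtain ⟨u, hu⟩ := hne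
    rw [Set.mem_iInter] at hu
    have hu₀ := hu ⟨a₀, ha₀⟩
    exact ⟨⟨u, hu₀.1, hu₀.2.trans hH a₀.2.2⟩, fun a ha => (hu ⟨a, ha⟩).2⟩
  obtain ⟨m, hm⟩ := exists_maximal_of_chains_bounded hbd fun h₁ h₂ => Geq.trans hH h₂ h₁
  -- Any state above `m` is also above `χ`, so maximality among the states above `χ` is maximality
  -- in all of `Q.S H`.
  exact ⟨m.1, ⟨m.2.1, fun ψ hψ h => hm ⟨ψ, hψ, h.trans hH m.2.2⟩ h⟩, m.2.2⟩

/-! ## Tensor powers and asymptotic rates -/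

theorem pow_mem (hH : H ∈ Q.systems) : ∀ n, H.pow n ∈ Q.systems
  | 0 => Q.unit_mem
  | n + 1 => Q.tensor_mem _ (pow_mem hH n) _ hH

theorem exists_free_map_pow (hH : H ∈ Q.systems) {φ ψ : TraceClass H} (h : Q.Geq φ ψ) (n : ℕ) :
    ∃ N ∈ Q.O (H.pow n) (H.pow n), N.map (φ.pow n) = ψ.pow n := by
  induction n with
  | zero => exact Geq.refl (Q := Q) Q.unit_mem unitState
  | succ n ih =>
    obtain ⟨M, hM, h₁⟩ := ih
    obtain ⟨N, hN, h₂⟩ := h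
    obtain ⟨P, hP, h₃⟩ := Q.tensor_free _ (pow_mem hH n) _ (pow_mem hH n) _ hH _ hH M hM N hN
    exact ⟨P, hP, (h₃ _ _).trans (by rw [h₁, h₂]; rfl)⟩

/-- Trace out the last factor, then absorb the remaining trivial system. -/
theorem exists_free_discard_one (hH : H ∈ Q.systems) {ψ : TraceClass H} (hψ : ψ ∈ Q.S H)
    (n : ℕ) : ∃ N ∈ Q.O (H.pow (n + 1)) (H.pow n), N.map (ψ.pow (n + 1)) = ψ.pow n := by
  have hn := pow_mem hH n
  obtain ⟨I, hI, h₁⟩ := Q.id_free _ hn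
  obtain ⟨T, hT, h₂⟩ := Q.trace_free H hH
  obtain ⟨P, hP, h₃⟩ := Q.tensor_free _ hn _ hn _ hH _ Q.unit_mem I hI T hT
  obtain ⟨R, hR, h₄⟩ := Q.rightUnit_free _ hn
  obtain ⟨N, hN, h₅⟩ := Q.comp_free _ (pow_mem hH (n + 1)) _ (Q.tensor_mem _ hn _ Q.unit_mem)
    _ hn P hP R hR
  have h₆ : T.map ψ = unitState :=
    Subtype.ext (by rw [h₂, (Q.S_subset H hH hψ).2, one_smul])
  refine ⟨N, hN, (h₅ _).trans ?_⟩
  have h₇ : P.map (ψ.pow (n + 1)) = (ψ.pow n).tensor unitState :=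
    (h₃ _ _).trans (by rw [h₁, h₆])
  exact (congrArg R.map h₇).trans (h₄ _)

theorem exists_free_discard (hH : H ∈ Q.systems) {ψ : TraceClass H} (hψ : ψ ∈ Q.S H)
    {k m : ℕ} (hkm : k ≤ m) : ∃ N ∈ Q.O (H.pow m) (H.pow k), N.map (ψ.pow m) = ψ.pow k := by
  induction m, hkm using Nat.le_induction with
  | base => exact Geq.refl (pow_mem hH k) _
  | succ m _ ih =>
    obtain ⟨M, hM, h₁⟩ := ih
    obtain ⟨D, hD, h₂⟩ := exists_free_discard_one hH hψ m
    obtain ⟨N, hN, h⟩ := Q.comp_free _ (pow_mem hH (m + 1)) _ (pow_mem hH m) _ (pow_mem hH k)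
      D hD M hM
    exact ⟨N, hN, by rw [h, h₂, h₁]⟩

theorem one_mem_achievableRates (hH : H ∈ Q.systems) {φ ψ : TraceClass H} (h : Q.Geq φ ψ) :
    1 ∈ Q.achievableRates φ ψ := by
  -- The exponent `⌈1 * n⌉₊` occurs in a type; a free variable `m` allows substitution.
  have key : ∀ n m : ℕ, m = n →
      ∃ N ∈ Q.O (H.pow n) (H.pow m), N.map (φ.pow n) = ψ.pow m := by
    rintro n _ rfl
    exact exists_free_map_pow hH h _
  choose N hN hmap using fun n : ℕ => key n ⌈(1 : ℝ) * n⌉₊ (by simp)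
  refine ⟨zero_le_one, N, hN, ?_⟩
  simp [hmap, traceDist]

/-- Run the two protocols in succession and discard the surplus copies due to rounding up twice.
Positivity of `r` sends the number of intermediate copies to infinity, so the second error vanishes.
-/
theorem mul_mem_achievableRates (hH : H ∈ Q.systems) (hK : K ∈ Q.systems) (hL : L ∈ Q.systems)
    {φ : TraceClass H} {ψ : TraceClass K} {χ : TraceClass L} (hχ : χ ∈ Q.S L) {r s : ℝ}
    (hr0 : 0 < r) (hr : r ∈ Q.achievableRates φ ψ) (hs : s ∈ Q.achievableRates ψ χ) :
    r * s ∈ Q.achievableRates φ χ := by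
  obtain ⟨-, M, hM, hMlim⟩ := hr
  obtain ⟨hs0, N, hN, hNlim⟩ := hs
  let m : ℕ → ℕ := fun n => ⌈r * n⌉₊
  have hm : Tendsto m atTop atTop :=
    tendsto_nat_ceil_atTop.comp (tendsto_natCast_atTop_atTop.const_mul_atTop hr0)
  have hle : ∀ n : ℕ, ⌈r * s * n⌉₊ ≤ ⌈s * m n⌉₊ := fun n => by
    refine Nat.ceil_mono ?_
    calc r * s * n = s * (r * n) := by ring
      _ ≤ s * m n := mul_le_mul_of_nonneg_left (Nat.le_ceil _) hs0
  choose D hD hDmap using fun n => exists_free_discard hL hχ (hle n)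
  choose P hP hPmap using fun n => Q.comp_free _ (pow_mem hH n) _ (pow_mem hK (m n)) _
    (pow_mem hL ⌈s * m n⌉₊) (M n) (hM n) (N (m n)) (hN (m n))
  choose R hR hRmap using fun n => Q.comp_free _ (pow_mem hH n) _ (pow_mem hL ⌈s * m n⌉₊) _
    (pow_mem hL ⌈r * s * n⌉₊) (P n) (hP n) (D n) (hD n)
  refine ⟨mul_nonneg hr0.le hs0, R, hR, ?_⟩
  have hlim := hMlim.add (hNlim.comp hm)
  rw [add_zero] at hlim
  refine squeeze_zero (fun n => norm_nonneg _) (fun n => ?_) hlim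
  -- Writing the target as an image under `D n` lets contractivity remove the discarding step; the
  -- two protocol errors then add.
  rw [hRmap, hPmap, ← hDmap n]
  refine ((D n).traceDist_map_le _ _).trans ((traceDist_triangle _ ((N (m n)).map (ψ.pow (m n)))
    _).trans ?_)
  exact add_le_add ((N (m n)).traceDist_map_le _ _) le_rfl

theorem pow_mem_achievableRates (hH : H ∈ Q.systems) {φ : TraceClass H} (hφ : φ ∈ Q.S H) {r : ℝ}
    (hr0 : 0 < r) (hr : r ∈ Q.achievableRates φ φ) (k : ℕ) : r ^ k ∈ Q.achievableRates φ φ := by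
  induction k with
  | zero => simpa using one_mem_achievableRates hH (Geq.refl hH φ)
  | succ k ih =>
    rw [pow_succ]
    exact mul_mem_achievableRates hH hH hH hφ (pow_pos hr0 k) ih hr

/-! ### Rates above one and finitely many maximal classes -/

theorem le_convRate {φ : TraceClass H} {ψ : TraceClass K} {r : ℝ}
    (hr : r ∈ Q.achievableRates φ ψ) : ENNReal.ofReal r ≤ Q.convRate φ ψ :=
  le_iSup₂ (f := fun r (_ : r ∈ Q.achievableRates φ ψ) => ENNReal.ofReal r) r hr

theorem exists_one_lt_of_one_lt_convRate {φ : TraceClass H} {ψ : TraceClass K}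
    (h : 1 < Q.convRate φ ψ) : ∃ r ∈ Q.achievableRates φ ψ, 1 < r := by
  obtain ⟨r, h⟩ := lt_iSup_iff.mp h
  obtain ⟨hr, h⟩ := lt_iSup_iff.mp h
  exact ⟨r, hr, ENNReal.one_lt_ofReal.mp h⟩

theorem convRate_self_eq_top (hH : H ∈ Q.systems) {φ : TraceClass H} (hφ : φ ∈ Q.S H) {r : ℝ}
    (h1 : 1 < r) (hr : r ∈ Q.achievableRates φ φ) : Q.convRate φ φ = ∞ := by
  refine ENNReal.eq_top_of_forall_nnreal_le fun x => ?_
  obtain ⟨k, hk⟩ := pow_unbounded_of_one_lt (x : ℝ) h1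
  refine le_trans ?_ (le_convRate (pow_mem_achievableRates hH hφ (one_pos.trans h1) hr k))
  rw [← ENNReal.ofReal_coe_nnreal]
  exact ENNReal.ofReal_le_ofReal hk.le

/-- If some maximally resourceful state is free, then every state is free. -/
theorem S_subset_F (hH : H ∈ Q.systems) {g : TraceClass H} (hG : g ∈ Q.G H) (hF : g ∈ Q.F H) :
    Q.S H ⊆ Q.F H := by
  intro χ hχ
  refine ⟨hχ, fun H' hH' φ hφ => ?_⟩
  obtain ⟨N, hN, h₁⟩ := hF.2 H hH χ hχ
  obtain ⟨M, hM, h₂⟩ := hG.2 χ hχ ⟨N, hN, h₁.symm⟩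
  obtain ⟨P, hP, h₃⟩ := hF.2 H' hH' φ hφ
  obtain ⟨R, hR, h⟩ := Q.comp_free _ hH' _ hH _ hH P hP M hM
  exact ⟨R, hR, by rw [h, ← h₃, h₂]⟩

/-- Among finitely many classes of maximally resourceful states, one cannot be reached from any
state at a rate above one. -/
theorem exists_mem_G_convRate_le_one (hH : H ∈ Q.systems)
    (hcat : ∀ ψ : TraceClass H, ¬ Q.IsCatalyticallyReplicable ψ)
    (hres : (Q.S H \ Q.F H).Nonempty) (hfin : (Q.maximalClasses H).Finite) :
    ∃ φ ∈ Q.G H, ∀ χ ∈ Q.S H, Q.convRate χ φ ≤ 1 := by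
  obtain ⟨ρ, hρS, hρF⟩ := hres
  by_contra! hcon
  have hstep : ∀ φ : Q.G H, ∃ g : Q.G H, ∃ r ∈ Q.achievableRates g.1 φ.1, 1 < r := by
    rintro ⟨φ, hφ⟩
    obtain ⟨χ, hχ, h⟩ := hcon φ hφ
    obtain ⟨r, hr, h1⟩ := exists_one_lt_of_one_lt_convRate h
    obtain ⟨g, hg, hgχ⟩ := exists_mem_G_geq hH hχ
    -- Replacing the source `χ` by a maximal `g` above it costs only a factor of one in the rate.
    have := mul_mem_achievableRates hH hH hH hφ.1 one_pos (one_mem_achievableRates hH hgχ) hr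
    exact ⟨⟨g, hg⟩, r, by simpa using this, h1⟩
  choose f hf using hstep
  obtain ⟨g₀, hg₀, -⟩ := exists_mem_G_geq hH hρS
  let g : ℕ → Q.G H := fun n => f^[n] ⟨g₀, hg₀⟩
  have hlt : ∀ m n, m < n → ∃ r ∈ Q.achievableRates (g n).1 (g m).1, 1 < r := by
    intro m n hmn
    have hsucc : ∀ n, ∃ r ∈ Q.achievableRates (g (n + 1)).1 (g n).1, 1 < r := fun n => by
      have : g (n + 1) = f (g n) := Function.iterate_succ_apply' f n _
      rw [this]
      exact hf (g n)
    induction n, hmn using Nat.le_induction with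
    | base => exact hsucc m
    | succ n _ ih =>
      obtain ⟨r, hr, hr1⟩ := hsucc n
      obtain ⟨s, hs, hs1⟩ := ih
      exact ⟨r * s, mul_mem_achievableRates hH hH hH (g m).2.1 (one_pos.trans hr1) hr hs,
        one_lt_mul_of_lt_of_le hr1 hs1.le⟩
  have : Finite (Q.maximalClasses H) := hfin
  -- Pigeonhole on the classes of the sequence.
  obtain ⟨m, n, hmn, heq⟩ := Finite.exists_ne_map_eq_of_infinite fun n =>
    (⟨{ψ | ψ ∈ Q.G H ∧ Q.Equivalent ψ (g n).1}, (g n).1, (g n).2, rfl⟩ : Q.maximalClasses H)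
  wlog hlt' : m < n generalizing m n
  · exact this n m hmn.symm heq.symm (lt_of_le_of_ne (not_lt.mp hlt') hmn.symm)
  have hequiv : Q.Geq (g m).1 (g n).1 := by
    have hset := Subtype.ext_iff.mp heq
    have hmem : (g m).1 ∈ {ψ | ψ ∈ Q.G H ∧ Q.Equivalent ψ (g m).1} :=
      ⟨(g m).2, Geq.refl hH _, Geq.refl hH _⟩
    simp only at hset
    rw [hset] at hmem
    exact hmem.2.1
  obtain ⟨r, hr, hr1⟩ := hlt m n hlt'
  -- The cycle closes: `g m` goes to `g n` at rate one, then back at rate `r > 1`.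
  have hself := mul_mem_achievableRates hH hH hH (g m).2.1 one_pos
    (one_mem_achievableRates hH hequiv) hr
  rw [one_mul] at hself
  exact hcat (g m).1 ⟨⟨(g m).2.1, fun hF => hρF (S_subset_F hH (g m).2 hF hρS)⟩,
    convRate_self_eq_top hH (g m).2.1 hr1 hself⟩

end QRT

theorem mainTheorem9 (Q : QRT) (H : QSystem) (hH : H ∈ Q.systems) (Rmax : ℝ≥0)
    (hcat : ∀ ψ : TraceClass H, ¬ Q.IsCatalyticallyReplicable ψ)
    (hres : (Q.S H \ Q.F H).Nonempty)
    (hfin : (Q.maximalClasses H).Finite) :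
    ∃ φ ∈ Q.G H, Q.resourceCost Rmax φ = (Rmax : ℝ≥0∞) := by
  obtain ⟨φ, hφ, hle⟩ := QRT.exists_mem_G_convRate_le_one hH hcat hres hfin
  refine ⟨φ, hφ, le_antisymm ?_ (le_iInf₂ fun χ hχ => ?_)⟩
  -- The candidate `φ` itself bounds the infimum from above.
  · have h1 := QRT.le_convRate (QRT.one_mem_achievableRates hH (QRT.Geq.refl hH φ))
    rw [ENNReal.ofReal_one] at h1
    refine (iInf₂_le φ hφ.1).trans ?_
    simpa using ENNReal.div_le_div_left h1 (Rmax : ℝ≥0∞)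
  · simpa using ENNReal.div_le_div_left (hle χ hχ) (Rmax : ℝ≥0∞)
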